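/- **The projective octagasket cell graphs.** Let $u_j$ ($j\in\mathbb Z/8$) be the vertices of a regular octagon $O$ (of circumradius $1$, with horizontal top side), numbered clockwise starting with the left end of the top side, and let $F_j$ be the homothety with centre $u_j$ and ratio $\rho=1/(2+\sqrt2)$. For $m\ge 0$, an $m$-cell is an octagon $F_{j_1}F_{j_2}\cdots F_{j_m}(O)$ with $j_1,\dots,j_m\in\mathbb Z/8$; there are $8^m$ of them, each with $8$ edges. The complement in the plane of the union of the $m$-cells has one unbounded component, whose boundary is called the outer boundary, and bounded components ("holes"), namely the inner holes of the $k$-cells, $k<m$, and of the pseudo-cells, i.e. the holes between neighbouring cells; each of these holes is centrally symmetric. Identify edges as follows: two edges that coincide as segments of the plane are identified; two edges on the boundary of the same hole are identified if they are antipodal with respect to the centre of that hole; two edges on the outer boundary are identified if they are antipodal with respect to the centre of $O$. Then each edge of an $m$-cell is identified with exactly one other edge. The level-$m$ cell graph $\Gamma_m$ of the projective octagasket has the $m$-cells as vertices, and two distinct $m$-cells are adjacent when some edge of one is identified with some edge of the other. Let $D_m$ be the path metric on $\Gamma_m$ (the least length of a path between two cells), and let $B_m(v,n)=\{w : D_m(v,w)\le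 n\}$. **Proposition 9.15.** For all integers $m,n\ge 1$ with $n<2^{m-1}$ and every $m$-cell $v$, $$\#B_m(v,n)\le 200\,n^3 .$$ -/

import Mathlib

/-!
The level-`m` cell graph of the projective octagasket.

Geometry.  Let `u j`, `j` in `ℤ/8`, be the corners of a regular octagon, numbered clockwise from
the left corner of the top side, and let side `e` be the side from corner `e` to corner `e + 1`
(so side `0` is the top side).  Let `F j` be the homothety with centre `u j` and ratio
`ρ = 1 / (2 + √2)`.  The `m`-cells are the octagons `F j₁ (F j₂ (⋯ F jₘ (octagon)))`; such a cell is
recorded by the word `[j₁, j₂, …, jₘ]`, the first letter giving the largest scale.  Because the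
`F j` do not rotate, side `d` of every cell is parallel to side `d` of the big octagon.  The edges
of the level-`m` picture are the pairs `(w, d)`: side `d` of the cell `w`.

Every edge is identified with exactly one other edge:
* the two coincide as segments in the plane (the cells are neighbours in the octagasket), or
* both lie on the boundary of the same hole, the hole inside a cell or inside a pseudo-cell
  (a ring of cells between two neighbouring cells), and are antipodal with respect to its centre, or
* both lie on the outer boundary of the big octagon and are antipodal with respect to its centre.

The half turn about the centre of a hole takes letters `j` to `j + 4` and side `d` to side `d + 4`.
-/

namespace POG

/-- A direction: the index of a corner or of a side of an octagon, in `ℤ/8`. -/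
abbrev Dir : Type := ZMod 8

/-- An address of finite length, with absolute letters `j₁, j₂, …`, largest scale first. -/
abbrev Word : Type := List Dir

/-- The cell that the half turn about the centre of the big octagon makes of the cell `s`. -/
def antipode (s : Word) : Word := s.map (fun j => j + 4)

/-- `OnSide e s d`: side `d` of the cell `s` is one of the edges into which side `e` of the big
octagon has been broken up.  When an octagon is replaced by eight smaller ones, its side `e` is
replaced by sides `e`, `e + 1` of the small octagon at corner `e`, followed by sides `e - 1`, `e` of
the small octagon at corner `e + 1`. -/
def OnSide : Dir → Word → Dir → Prop
  | e, [], d => d = e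
  | e, j :: s, d =>
      (j = e ∧ (OnSide e s d ∨ OnSide (e + 1) s d)) ∨
      (j = e + 1 ∧ (OnSide (e - 1) s d ∨ OnSide e s d))

/-- Two copies `A`, `B` of the big octagon are placed next to each other so that side `e` of `A` is
side `e + 4` of `B`.  `Seam e s d s' d'`: side `d` of the cell `s` of `A` is identified with side
`d'` of the cell `s'` of `B` along this common side.

With no subdivision the common side is one edge.  Otherwise the small octagons `e` and `e + 1` of
`A` have their side `e` in common with the small octagons `e + 5` and `e + 4` of `B`, and the same
structure is repeated there at both ends of the seam.  The side `e + 1` of small octagon `e` and the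
side `e - 1` of small octagon `e + 1` of `A` face the hole in the middle (the hole of a pseudo-cell),
and across it `A` and `B` are identified antipodally. -/
def Seam : Dir → Word → Dir → Word → Dir → Prop
  | e, [], d, [], d' => d = e ∧ d' = e + 4
  | e, j :: s, d, j' :: s', d' =>
      (((j = e ∧ j' = e + 5) ∨ (j = e + 1 ∧ j' = e + 4)) ∧ Seam e s d s' d') ∨
      (((j = e ∧ OnSide (e + 1) s d) ∨ (j = e + 1 ∧ OnSide (e - 1) s d)) ∧
        j' = j + 4 ∧ s' = antipode s ∧ d' = d + 4)
  | _, _, _, _, _ => False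

/-- The identifications of edges of the big octagon other than those of its outer boundary,
obtained from eight copies of the picture one level lower:
* the identifications inside each copy (without the outer boundary of the copy);
* those along the common side (side `j + 2` of copy `j`) of consecutive copies `j` and `j + 1`;
* those of the hole in the middle, which is bounded by the sides `j + 3` and `j + 4` of every copy
  `j`, antipodally. -/
def InteriorGlued : Word → Dir → Word → Dir → Prop
  | j :: s, d, j' :: s', d' =>
      (j' = j ∧ InteriorGlued s d s' d') ∨
      (j' = j + 1 ∧ Seam (j + 2) s d s' d') ∨
      ((OnSide (j + 3) s d ∨ OnSide (j + 4) s d) ∧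
        j' = j + 4 ∧ s' = antipode s ∧ d' = d + 4)
  | _, _, _, _ => False

/-- All identifications of edges: the interior ones, and the antipodal identification of the edges
on the outer boundary of the big octagon.  An identification along the common side of copies `j` and
`j + 1` is recorded in one direction only; `cellGraph` symmetrizes. -/
def Glued (w : Word) (d : Dir) (w' : Word) (d' : Dir) : Prop :=
  InteriorGlued w d w' d' ∨ ((∃ e, OnSide e w d) ∧ w' = antipode w ∧ d' = d + 4)

/-- The `m`-cells. -/
abbrev Cell (m : ℕ) : Type := List.Vector Dir m

/-- The level-`m` cell graph: two distinct `m`-cells are adjacent when an edge of one is identified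
with an edge of the other. -/
def cellGraph (m : ℕ) : SimpleGraph (Cell m) :=
  SimpleGraph.fromRel fun v w => ∃ d d' : Dir, Glued v.toList d w.toList d'

/-- The closed ball of radius `n` about `v` in the path metric of the level-`m` cell graph: the
cells that can be reached from `v` by a path of length at most `n`. -/
def ball (m : ℕ) (v : Cell m) (n : ℕ) : Set (Cell m) :=
  {w | (cellGraph m).edist v w ≤ n}

end POG

/-!
Call two cells touching if they share a vertex of the glued surface. Adjacent cells touch, so it is
enough to bound balls for this larger graph.

The bound comes from a change of scale: two steps between touching `m`-cells `u`, `v`, `w` project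
to at most one step between touching `(m - 1)`-cells. Indeed `v` sits at one corner of the cell `X`
that contains it, and it only meets cells contained in the cells around that one corner of `X`
(`AtCorner.tail`); thus the cells containing `u` and `w` have a vertex in common
(`Touches.tail_of_touches`). Halving `k` times, all cells within distance `2 ^ k` of `v` lie in the
cells touching the ancestor of `v` that is `k` levels up (`touches_drop`). At most four cells meet
at a vertex (`star`), so at most `1 + 8 * 3 = 25` cells touch a given one, and each has `8 ^ k`
descendants. Taking `2 ^ (k - 1) ≤ n < 2 ^ k` gives `25 * 8 ^ k ≤ 200 * n ^ 3`.

The combinatorics of the vertices is handled by writing words with the smallest scale first. Then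
the neighbour of a cell across a side is given by a structural recursion (`across`) in which only
the sides on the boundary of the parent cell recur, and which records whether the two edges
coincide in the plane (a seam) or are antipodal. Around every vertex, seams and antipodal gluings
give two commuting involutions on the corners meeting there (`seam_anti`), and the orbits are the
vertices. The recursive definition of the gluing, which proceeds from the largest scale, is
compared with `across` by adding letters one at a time below a pair of neighbouring cells
(`across_of_onSide`, `across_of_seam`, `across_of_interiorGlued`).
-/

namespace POG

/-! ### Neighbours of a cell -/

/-- The recursion step of `across`: the neighbour of the cell `j :: X` across its side `j + r`,
where `p` and `q` are the values of `across X` at the sides `j` and `j - 1` of `X`, which meet at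
the corner `j` occupied by `j :: X`. The sides `j` and `j + 1` of `j :: X` lie on side `j` of `X`,
the sides `j - 2` and `j - 1` on side `j - 1` of `X`; the remaining four are interior to `X`. When
two cells are joined along a seam, only the outer edges of the seam are again seams (`r = 0` and
`r = 7`), the two others (`r = 1` and `r = 6`) face the hole in the middle. -/
def acrossStep (j r : Dir) (X : Word) (p q : Word × Bool) : Word × Bool :=
  match r with
  | 0 => ((bif p.2 then j + 5 else j + 4) :: p.1, p.2)
  | 1 => ((j + 4) :: p.1, false)
  | 2 => ((j + 1) :: X, true)
  | 3 => ((j + 4) :: X, false)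
  | 4 => ((j + 4) :: X, false)
  | 5 => ((j - 1) :: X, true)
  | 6 => ((j + 4) :: q.1, false)
  | 7 => ((bif q.2 then j + 3 else j + 4) :: q.1, q.2)

/-- The cell across side `d` of the cell `X`, together with the kind of the identification: `true`
when the two edges coincide in the plane, `false` when they are antipodal on a hole or on the outer
boundary. In contrast to the words of `Cell`, the word `X` has the letter of the *smallest* scale
first, so that the tail of a cell is the cell one level up that contains it. In both cases the
neighbour is entered through its side `d + 4`. -/
def across : Word → Dir → Word × Bool
  | [], _ => ([], false)
  | j :: X, d => acrossStep j (d - j) X (across X j) (across X (j - 1))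

theorem across_cons {j d : Dir} (r : Dir) (X : Word) (h : d = j + r) :
    across (j :: X) d = acrossStep j r X (across X j) (across X (j - 1)) := by
  simp [across, h]

theorem eight_eq_zero : (8 : Dir) = 0 := rfl

/-- Case distinction on a direction, counted from the letter `j` of a cell. -/
theorem eq_add_of_dir (j c : Dir) : c = j + 0 ∨ c = j + 1 ∨ c = j + 2 ∨ c = j + 3 ∨ c = j + 4 ∨
    c = j + 5 ∨ c = j + 6 ∨ c = j + 7 := by
  revert j c; decide

theorem across_across (X : Word) (d : Dir) :
    across (across X d).1 (d + 4) = (X, (across X d).2) := by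
  induction X generalizing d with
  | nil => rfl
  | cons j X ih =>
    have hp := ih j
    have hq := ih (j - 1)
    have close (a b : Dir) (W : Word) (t : Bool) (hab : a = b) :
      (a :: W, t) = (b :: W, t) := by rw [hab]
    rw [show j - 1 + 4 = j + 3 by ring] at hq
    rcases eq_add_of_dir j d with rfl | rfl | rfl | rfl | rfl | rfl | rfl | rfl <;>
      rw [across_cons (j := j) _ X rfl]
    · rcases h : across X j with ⟨Y, _ | _⟩ <;> rw [h] at hp
      · change across ((j + 4) :: Y) (j + 0 + 4) = _
        rw [across_cons 0 Y (by ring), hp]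
        exact close (j + 4 + 4) j _ _ (by linear_combination eight_eq_zero)
      · change across ((j + 5) :: Y) (j + 0 + 4) = _
        rw [across_cons 7 Y (by linear_combination -eight_eq_zero),
          show j + 5 - 1 = j + 4 by ring, hp]
        exact close (j + 5 + 3) j _ _ (by linear_combination eight_eq_zero)
    · change across ((j + 4) :: (across X j).1) (j + 1 + 4) = _
      rw [across_cons 1 _ (by ring), hp]
      exact close _ _ _ _ (by linear_combination eight_eq_zero)
    · change across ((j + 1) :: X) (j + 2 + 4) = _
      rw [across_cons 5 _ (by ring)]
      exact close _ _ _ _ (by ring)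
    · change across ((j + 4) :: X) (j + 3 + 4) = _
      rw [across_cons 3 _ (by ring)]
      exact close _ _ _ _ (by linear_combination eight_eq_zero)
    · change across ((j + 4) :: X) (j + 4 + 4) = _
      rw [across_cons 4 _ (by ring)]
      exact close _ _ _ _ (by linear_combination eight_eq_zero)
    · change across ((j - 1) :: X) (j + 5 + 4) = _
      rw [across_cons 2 _ (by linear_combination eight_eq_zero)]
      exact close _ _ _ _ (by ring)
    · change across ((j + 4) :: (across X (j - 1)).1) (j + 6 + 4) = _
      rw [across_cons 6 _ (by ring), show j + 4 - 1 = j + 3 by ring, hq]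
      exact close _ _ _ _ (by linear_combination eight_eq_zero)
    · rcases h : across X (j - 1) with ⟨Y, _ | _⟩ <;> rw [h] at hq
      · change across ((j + 4) :: Y) (j + 7 + 4) = _
        rw [across_cons 7 Y (by ring), show j + 4 - 1 = j + 3 by ring, hq]
        exact close (j + 4 + 4) j _ _ (by linear_combination eight_eq_zero)
      · change across ((j + 3) :: Y) (j + 7 + 4) = _
        rw [across_cons 0 Y (by linear_combination eight_eq_zero), hq]
        exact close (j + 3 + 5) j _ _ (by linear_combination eight_eq_zero)


/-! ### Corners and the vertices at which they meet -/

/-- A corner of a cell, the word being written smallest scale first as in `across`. -/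
abbrev Corner : Type := Word × Dir

/-- The recursion step of `antiCell` at the corner `j + r` of `j :: X`; `A`, `P` and `Q` are the
values at `X` of `antiCell` at the corner `j` and of `across` at the sides `j` and `j - 1`. -/
def antiStep (r : Dir) (X A P Q : Word) : Word :=
  match r with
  | 0 => A
  | 1 => P
  | 2 => P
  | 3 => X
  | 4 => X
  | 5 => X
  | 6 => Q
  | 7 => Q

/-- The cell to which `X` is antipodally glued at its corner `c`. At least one of the two sides
meeting at a corner is glued antipodally, and if both are, they lead to the same corner. The
antipodal gluing takes corner `c` to corner `c + 4`. -/
def antiCell : Word → Dir → Word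
  | [], _ => []
  | j :: X, c =>
    (j + 4) :: antiStep (c - j) X (antiCell X j) (across X j).1 (across X (j - 1)).1

theorem antiCell_cons {j c : Dir} (r : Dir) (X : Word) (h : c = j + r) :
    antiCell (j :: X) c =
      (j + 4) :: antiStep r X (antiCell X j) (across X j).1 (across X (j - 1)).1 := by
  simp [antiCell, h]

/-- The recursion step of `seamCorner` at the corner `j + r` of `j :: X`; `s`, `p` and `q` are the
values at `X` of `seamCorner` at the corner `j` and of `across` at the sides `j` and `j - 1`. -/
def seamStep (j r : Dir) (X : Word) (s : Corner) (p q : Word × Bool) : Corner :=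
  match r with
  | 0 => (s.2 :: s.1, s.2)
  | 1 => bif p.2 then ((j + 5) :: p.1, j + 4) else (j :: X, j + 1)
  | 2 => ((j + 1) :: X, j + 7)
  | 3 => ((j + 1) :: X, j + 6)
  | 4 => (j :: X, j + 4)
  | 5 => ((j - 1) :: X, j + 2)
  | 6 => ((j - 1) :: X, j + 1)
  | 7 => bif q.2 then ((j + 3) :: q.1, j + 4) else (j :: X, j + 7)

/-- The corner glued to the corner `c` of `X` along the seam among the two sides meeting there, and
the corner itself if both sides are glued antipodally. -/
def seamCorner : Word → Dir → Corner
  | [], c => ([], c)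
  | j :: X, c => seamStep j (c - j) X (seamCorner X j) (across X j) (across X (j - 1))

theorem seamCorner_cons {j c : Dir} (r : Dir) (X : Word) (h : c = j + r) :
    seamCorner (j :: X) c =
      seamStep j r X (seamCorner X j) (across X j) (across X (j - 1)) := by
  simp [seamCorner, h]

theorem corner_ext {a b c d : Dir} {V W : Word} (hab : a = b) (hVW : V = W) (hcd : c = d) :
    ((a :: V, c) : Corner) = (b :: W, d) := by
  rw [hab, hVW, hcd]

theorem antiCell_antiCell (X : Word) (c : Dir) : antiCell (antiCell X c) (c + 4) = X := by
  induction X generalizing c with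
  | nil => rfl
  | cons j X ih =>
    have hA := ih j
    have hp := congrArg Prod.fst (across_across X j)
    have hq := congrArg Prod.fst (across_across X (j - 1))
    rw [show j - 1 + 4 = j + 4 - 1 by ring] at hq
    have hj : j + 4 + 4 = j := by linear_combination eight_eq_zero
    rcases eq_add_of_dir j c with rfl | rfl | rfl | rfl | rfl | rfl | rfl | rfl <;>
      rw [antiCell_cons (j := j) _ X rfl, antiCell_cons (j := j + 4) _ _ (add_right_comm _ _ _),
        hj] <;> congr 1

theorem seamCorner_seamCorner (X : Word) (c : Dir) :
    seamCorner (seamCorner X c).1 (seamCorner X c).2 = (X, c) := by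
  induction X generalizing c with
  | nil => rfl
  | cons j X ih =>
    have hA := ih j
    have hp := across_across X j
    have hq := across_across X (j - 1)
    rw [show j - 1 + 4 = j + 3 by ring] at hq
    rcases eq_add_of_dir j c with rfl | rfl | rfl | rfl | rfl | rfl | rfl | rfl <;>
      rw [seamCorner_cons (j := j) _ X rfl]
    · dsimp only [seamStep]
      rw [seamCorner_cons 0 _ (add_zero _).symm]
      dsimp only [seamStep]
      rw [hA, add_zero]
    · rcases h : across X j with ⟨Y, _ | _⟩ <;> rw [h] at hp
      · change seamCorner (j :: X) (j + 1) = _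
        rw [seamCorner_cons 1 _ rfl, h]
        rfl
      · change seamCorner ((j + 5) :: Y) (j + 4) = _
        rw [seamCorner_cons 7 _ (by linear_combination -eight_eq_zero),
          show j + 5 - 1 = j + 4 by ring, hp]
        exact corner_ext (by linear_combination eight_eq_zero) rfl
          (by linear_combination eight_eq_zero)
    · change seamCorner ((j + 1) :: X) (j + 7) = _
      rw [seamCorner_cons 6 _ (by ring)]
      exact corner_ext (by ring) rfl (by ring)
    · change seamCorner ((j + 1) :: X) (j + 6) = _
      rw [seamCorner_cons 5 _ (by ring)]
      exact corner_ext (by ring) rfl (by ring)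
    · change seamCorner (j :: X) (j + 4) = _
      rw [seamCorner_cons 4 _ rfl]
      rfl
    · change seamCorner ((j - 1) :: X) (j + 2) = _
      rw [seamCorner_cons 3 _ (by ring)]
      exact corner_ext (by ring) rfl (by ring)
    · change seamCorner ((j - 1) :: X) (j + 1) = _
      rw [seamCorner_cons 2 _ (by ring)]
      exact corner_ext (by ring) rfl (by ring)
    · rcases h : across X (j - 1) with ⟨Y, _ | _⟩ <;> rw [h] at hq
      · change seamCorner (j :: X) (j + 7) = _
        rw [seamCorner_cons 7 _ rfl, h]
        rfl
      · change seamCorner ((j + 3) :: Y) (j + 4) = _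
        rw [seamCorner_cons 1 _ (by ring), hq]
        exact corner_ext (by linear_combination eight_eq_zero) rfl (by ring)

/-- The two ways around a vertex agree: crossing the antipodal side first and the seam second, or
the other way round. Hence at most four corners meet at a vertex. -/
theorem seamCorner_antiCell (X : Word) (c : Dir) :
    seamCorner (antiCell X c) (c + 4) =
      (antiCell (seamCorner X c).1 (seamCorner X c).2, (seamCorner X c).2 + 4) := by
  induction X generalizing c with
  | nil => rfl
  | cons j X ih =>
    have hA := ih j
    have hp := across_across X j
    have hq := across_across X (j - 1)
    rw [show j - 1 + 4 = j + 3 by ring] at hq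
    rcases eq_add_of_dir j c with rfl | rfl | rfl | rfl | rfl | rfl | rfl | rfl <;>
      rw [seamCorner_cons (j := j) _ X rfl, antiCell_cons (j := j) _ X rfl,
        seamCorner_cons (j := j + 4) _ _ (add_right_comm _ _ _)]
    · dsimp only [seamStep, antiStep]
      rw [antiCell_cons 0 _ (add_zero _).symm, hA]
      rfl
    · dsimp only [antiStep]
      rw [hp]
      rcases h : across X j with ⟨Y, _ | _⟩ <;> rw [h] at hp
      · change _ = (antiCell (j :: X) (j + 1), j + 1 + 4)
        rw [antiCell_cons 1 _ rfl, h]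
        exact corner_ext rfl rfl (by ring)
      · change _ = (antiCell ((j + 5) :: Y) (j + 4), j + 4 + 4)
        rw [antiCell_cons 7 _ (by linear_combination -eight_eq_zero),
          show j + 5 - 1 = j + 4 by ring, hp]
        exact corner_ext (by ring) rfl (by ring)
    · change _ = (antiCell ((j + 1) :: X) (j + 7), j + 7 + 4)
      rw [antiCell_cons 6 _ (by ring), add_sub_cancel_right]
      exact corner_ext (by ring) rfl (by ring)
    · change _ = (antiCell ((j + 1) :: X) (j + 6), j + 6 + 4)
      rw [antiCell_cons 5 _ (by ring)]
      exact corner_ext (by ring) rfl (by ring)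
    · change _ = (antiCell (j :: X) (j + 4), _)
      rw [antiCell_cons 4 _ rfl]
      rfl
    · change _ = (antiCell ((j - 1) :: X) (j + 2), j + 2 + 4)
      rw [antiCell_cons 3 _ (by ring)]
      exact corner_ext (by ring) rfl (by ring)
    · change _ = (antiCell ((j - 1) :: X) (j + 1), j + 1 + 4)
      rw [antiCell_cons 2 _ (by ring)]
      exact corner_ext (by ring) rfl (by ring)
    · dsimp only [antiStep]
      rw [show j + 4 - 1 = j + 3 by ring, hq]
      rcases h : across X (j - 1) with ⟨Y, _ | _⟩ <;> rw [h] at hq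
      · change _ = (antiCell (j :: X) (j + 7), j + 7 + 4)
        rw [antiCell_cons 7 _ rfl, h]
        exact corner_ext rfl rfl (by ring)
      · change _ = (antiCell ((j + 3) :: Y) (j + 4), j + 4 + 4)
        rw [antiCell_cons 1 _ (by ring), hq]
        exact corner_ext (by ring) rfl (by ring)

/-- `antiCell` as an involution of the corners. -/
def anti (p : Corner) : Corner := (antiCell p.1 p.2, p.2 + 4)

/-- `seamCorner` as an involution of the corners. -/
def seam (p : Corner) : Corner := seamCorner p.1 p.2

theorem anti_anti (p : Corner) : anti (anti p) = p :=
  Prod.ext (antiCell_antiCell _ _)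
    (show p.2 + 4 + 4 = p.2 by linear_combination eight_eq_zero)

theorem seam_seam (p : Corner) : seam (seam p) = p := seamCorner_seamCorner _ _

theorem seam_anti (p : Corner) : seam (anti p) = anti (seam p) := seamCorner_antiCell _ _

/-- The corners of cells that are glued together at the vertex represented by `p`: the orbit of `p`
under the commuting involutions `anti` and `seam`. -/
def star (p : Corner) : Finset Corner := {p, anti p, seam p, anti (seam p)}

theorem mem_star_self (p : Corner) : p ∈ star p := by simp [star]

theorem anti_mem_star (p : Corner) : anti p ∈ star p := by simp [star]

theorem seam_mem_star (p : Corner) : seam p ∈ star p := by simp [star]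

theorem star_eq_of_mem {p q : Corner} (h : q ∈ star p) : star q = star p := by
  simp only [star, Finset.mem_insert, Finset.mem_singleton] at h
  rcases h with rfl | rfl | rfl | rfl <;> ext x <;>
    simp only [star, Finset.mem_insert, Finset.mem_singleton, seam_anti, anti_anti, seam_seam] <;>
    tauto

/-- Crossing side `d` carries the corner `d`, where that side starts, to one of its images under
`seam` and `anti`. -/
theorem across_start (X : Word) (d : Dir) :
    bif (across X d).2 then seamCorner X d = ((across X d).1, d + 5)
      else antiCell X d = (across X d).1 := by
  induction X generalizing d with
  | nil => rfl
  | cons j X ih =>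
    have hA := ih j
    rcases eq_add_of_dir j d with rfl | rfl | rfl | rfl | rfl | rfl | rfl | rfl <;>
      rw [seamCorner_cons (j := j) _ X rfl, antiCell_cons (j := j) _ X rfl,
        across_cons (j := j) _ X rfl]
    · rcases h : across X j with ⟨Y, _ | _⟩ <;> rw [h] at hA
      · exact congrArg _ hA
      · change (_ :: _, _) = ((_ :: _, _) : Corner)
        rw [show seamCorner X j = (Y, j + 5) from hA]
        exact corner_ext rfl rfl (by ring)
    · rfl
    · exact corner_ext rfl rfl (by ring)
    · rfl
    · rfl
    · exact corner_ext rfl rfl (by linear_combination -eight_eq_zero)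
    · rfl
    · rcases h : across X (j - 1) with ⟨Y, _ | _⟩
      · rfl
      · exact corner_ext rfl rfl (by linear_combination -eight_eq_zero)

/-- Crossing side `c - 1` carries the corner `c`, where that side ends, to one of its images under
`seam` and `anti`. -/
theorem across_end (X : Word) (c : Dir) :
    bif (across X (c - 1)).2 then seamCorner X c = ((across X (c - 1)).1, c + 3)
      else antiCell X c = (across X (c - 1)).1 := by
  induction X generalizing c with
  | nil => rfl
  | cons j X ih =>
    have hA := ih j
    rcases eq_add_of_dir j c with rfl | rfl | rfl | rfl | rfl | rfl | rfl | rfl <;>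
      rw [seamCorner_cons (j := j) _ X rfl, antiCell_cons (j := j) _ X rfl]
    · rw [across_cons 7 X (by linear_combination -eight_eq_zero)]
      rcases h : across X (j - 1) with ⟨Y, _ | _⟩ <;> rw [h] at hA
      · exact congrArg _ hA
      · change (_ :: _, _) = ((_ :: _, _) : Corner)
        rw [show seamCorner X j = (Y, j + 3) from hA]
        exact corner_ext rfl rfl (by ring)
    · rw [across_cons 0 X (by ring)]
      rcases h : across X j with ⟨Y, _ | _⟩
      · rfl
      · exact corner_ext rfl rfl (by ring)
    · rw [across_cons 1 X (by ring)]
      rfl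
    · rw [across_cons 2 X (by ring)]
      exact corner_ext rfl rfl (by ring)
    · rw [across_cons 3 X (by ring)]
      rfl
    · rw [across_cons 4 X (by ring)]
      rfl
    · rw [across_cons 5 X (by ring)]
      exact corner_ext rfl rfl (by linear_combination -eight_eq_zero)
    · rw [across_cons 6 X (by ring)]
      rfl

theorem exists_across_mem_star (X : Word) (d : Dir) :
    ∃ c, ((across X d).1, c) ∈ star (X, d) := by
  have h := across_start X d
  rcases h' : (across X d).2 <;> rw [h'] at h
  · exact ⟨d + 4, by rw [← show antiCell X d = (across X d).1 from h]; exact anti_mem_star _⟩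
  · refine ⟨d + 5, ?_⟩
    rw [← show seamCorner X d = ((across X d).1, d + 5) from h]
    exact seam_mem_star (X, d)

theorem exists_across_sub_one_mem_star (X : Word) (c : Dir) :
    ∃ c', ((across X (c - 1)).1, c') ∈ star (X, c) := by
  have h := across_end X c
  rcases h' : (across X (c - 1)).2 <;> rw [h'] at h
  · exact ⟨c + 4, by rw [← show antiCell X c = (across X (c - 1)).1 from h]; exact anti_mem_star _⟩
  · refine ⟨c + 3, ?_⟩
    rw [← show seamCorner X c = ((across X (c - 1)).1, c + 3) from h]
    exact seam_mem_star (X, c)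

/-! ### Touching cells and change of scale -/

/-- The cell `w` has a corner at the vertex represented by `p`. -/
def AtCorner (w : Word) (p : Corner) : Prop := ∃ c, (w, c) ∈ star p

/-- A cell that shares a vertex with the subcell `j :: X` lies in a cell that has a corner at the
corner `j` of `X`: either the shared vertex is the corner `j` of `X`, or it lies inside `X` or
inside one of the two sides of `X` that end there. -/
theorem AtCorner.tail {w X : Word} {j c : Dir} (h : AtCorner w (j :: X, c)) :
    AtCorner w.tail (X, j) := by
  have h0 : AtCorner X (X, j) := ⟨j, mem_star_self _⟩
  have hA : AtCorner (antiCell X j) (X, j) := ⟨j + 4, anti_mem_star (X, j)⟩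
  have hS : AtCorner (seamCorner X j).1 (X, j) := ⟨_, seam_mem_star (X, j)⟩
  have hAS : AtCorner (seamCorner (antiCell X j) (j + 4)).1 (X, j) := by
    rw [seamCorner_antiCell]
    exact ⟨(seamCorner X j).2 + 4, by simp [star, anti, seam]⟩
  have hP : AtCorner (across X j).1 (X, j) := exists_across_mem_star X j
  have hQ : AtCorner (across X (j - 1)).1 (X, j) := exists_across_sub_one_mem_star X j
  obtain ⟨c', h⟩ := h
  simp only [star, Finset.mem_insert, Finset.mem_singleton] at h
  rcases h with h | h | h | h
  · cases h
    exact h0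
  · obtain rfl : w = antiCell (j :: X) c := congrArg Prod.fst h
    rcases eq_add_of_dir j c with rfl | rfl | rfl | rfl | rfl | rfl | rfl | rfl <;>
      rw [antiCell_cons (j := j) _ X rfl] <;> assumption
  · obtain rfl : w = (seamCorner (j :: X) c).1 := congrArg Prod.fst h
    rcases eq_add_of_dir j c with rfl | rfl | rfl | rfl | rfl | rfl | rfl | rfl <;>
      rw [seamCorner_cons (j := j) _ X rfl]
    on_goal 2 =>
      rcases hp : across X j with ⟨Y, _ | _⟩ <;> rw [hp] at hP <;> assumption
    on_goal 7 =>
      rcases hq : across X (j - 1) with ⟨Y, _ | _⟩ <;> rw [hq] at hQ <;> assumption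
    all_goals assumption
  · rw [← seam_anti] at h
    obtain rfl : w = (seamCorner (antiCell (j :: X) c) (c + 4)).1 := congrArg Prod.fst h
    rcases eq_add_of_dir j c with rfl | rfl | rfl | rfl | rfl | rfl | rfl | rfl <;>
      rw [antiCell_cons (j := j) _ X rfl,
        seamCorner_cons (j := j + 4) _ _ (add_right_comm _ _ _)]
    -- At these two corners the seam, if there is one, leads back from the antipodal cell into `X`.
    on_goal 2 =>
      dsimp only [antiStep]
      rw [across_across]
      rcases hp : across X j with ⟨Y, _ | _⟩ <;> rw [hp] at hP <;> assumption
    on_goal 7 =>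
      dsimp only [antiStep]
      rw [show j + 4 - 1 = j - 1 + 4 by ring, across_across]
      rcases hq : across X (j - 1) with ⟨Y, _ | _⟩ <;> rw [hq] at hQ <;> assumption
    all_goals assumption

/-- The cells `v` and `w` share a vertex, or are equal. -/
def Touches (v w : Word) : Prop := ∃ c, AtCorner w (v, c)

theorem Touches.refl (v : Word) : Touches v v := ⟨0, 0, mem_star_self _⟩

theorem AtCorner.touches {v w : Word} {p : Corner} (hv : AtCorner v p) (hw : AtCorner w p) :
    Touches v w := by
  obtain ⟨c, hc⟩ := hv
  obtain ⟨c', hc'⟩ := hw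
  exact ⟨c, c', by rwa [star_eq_of_mem hc]⟩

theorem Touches.symm {v w : Word} (h : Touches v w) : Touches w v := by
  obtain ⟨c, h⟩ := h
  exact h.touches ⟨c, mem_star_self _⟩

theorem touches_across (X : Word) (d : Dir) : Touches X (across X d).1 :=
  ⟨d, exists_across_mem_star X d⟩

/-- Two steps between touching cells are at most one step between touching cells one level up: the
cells containing `u` and `w` both have a corner at the corner of `v.tail` that `v` occupies. -/
theorem Touches.tail_of_touches {u v w : Word} (huv : Touches u v) (hvw : Touches v w) :
    Touches u.tail w.tail := by
  obtain ⟨a, ha⟩ := huv.symm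
  obtain ⟨b, hb⟩ := hvw
  cases v with
  | nil =>
    have key (x : Word) (c : Dir) (h : AtCorner x ([], c)) : x = [] := by
      obtain ⟨e, h⟩ := h
      simp only [star, anti, seam, antiCell, seamCorner, Finset.mem_insert, Finset.mem_singleton,
        Prod.mk.injEq] at h
      tauto
    rw [key u a ha, key w b hb]
    exact .refl _
  | cons j X => exact ha.tail.touches hb.tail

/-- By halving `k` times, `2 ^ k` steps between touching cells are a single step `k` levels up. -/
theorem touches_drop (f : ℕ → Word) (hf : ∀ i, Touches (f i) (f (i + 1))) (k : ℕ) :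
    Touches ((f 0).drop k) ((f (2 ^ k)).drop k) := by
  induction k generalizing f with
  | zero => simpa using hf 0
  | succ k ih =>
    have := ih (fun i => (f (2 * i)).tail) fun i => (hf (2 * i)).tail_of_touches (hf (2 * i + 1))
    simpa [List.drop_tail, pow_succ'] using this

/-! ### The gluing of edges in terms of neighbours -/

/-- An antipodal gluing of side `e` of `A` to `B` is inherited by the edges into which this side is
broken up. The words `s` of `OnSide` have the largest scale first, whence the reversals. -/
theorem across_of_onSide {A B : Word} {e d : Dir} {s : Word} (h : across A e = (B, false))
    (hs : OnSide e s d) :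
    across (s.reverse ++ A) d = ((antipode s).reverse ++ B, false) := by
  induction s generalizing e A B with
  | nil =>
    obtain rfl : d = e := hs
    exact h
  | cons j s ih =>
    simp only [antipode, List.map_cons, List.reverse_cons, List.append_assoc,
      List.singleton_append]
    rcases hs with ⟨rfl, hs | hs⟩ | ⟨rfl, hs | hs⟩ <;> refine ih ?_ hs
    · rw [across_cons 0 _ (by ring), h]
      rfl
    · rw [across_cons 1 _ rfl, h]
      rfl
    · rw [across_cons 6 _ (by linear_combination -eight_eq_zero), add_sub_cancel_right, h]
      rfl
    · rw [across_cons 7 _ (by linear_combination -eight_eq_zero), add_sub_cancel_right, h]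
      rfl

/-- A seam along side `e` of `A` and the cell `B` across it is broken up as `Seam` prescribes. -/
theorem across_of_seam {A B : Word} {e d d' : Dir} {s s' : Word} (h : across A e = (B, true))
    (hs : Seam e s d s' d') : ∃ t, across (s.reverse ++ A) d = (s'.reverse ++ B, t) := by
  induction s generalizing e A B s' with
  | nil =>
    cases s' with
    | nil =>
      obtain ⟨rfl, -⟩ := hs
      exact ⟨_, h⟩
    | cons j' s' => exact hs.elim
  | cons j s ih =>
    cases s' with
    | nil => exact hs.elim
    | cons j' s' =>
      simp only [List.reverse_cons, List.append_assoc, List.singleton_append]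
      rcases hs with ⟨⟨rfl, rfl⟩ | ⟨rfl, rfl⟩, hs⟩ | ⟨⟨rfl, hs⟩ | ⟨rfl, hs⟩, rfl, rfl, -⟩
      · refine ih ?_ hs
        rw [across_cons 0 _ (by ring), h]
        rfl
      · refine ih ?_ hs
        rw [across_cons 7 _ (by linear_combination -eight_eq_zero), add_sub_cancel_right, h]
        exact congrArg (fun j => (j :: B, true)) (show e + 1 + 3 = e + 4 by ring)
      · refine ⟨_, across_of_onSide ?_ hs⟩
        rw [across_cons 1 _ rfl, h]
        rfl
      · refine ⟨_, across_of_onSide ?_ hs⟩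
        rw [across_cons 6 _ (by linear_combination -eight_eq_zero), add_sub_cancel_right, h]
        rfl

theorem across_of_interiorGlued {s s' : Word} {d d' : Dir} (h : InteriorGlued s d s' d')
    (A : Word) : ∃ t, across (s.reverse ++ A) d = (s'.reverse ++ A, t) := by
  induction s generalizing s' A with
  | nil => exact h.elim
  | cons j s ih =>
    cases s' with
    | nil => exact h.elim
    | cons j' s' =>
      simp only [List.reverse_cons, List.append_assoc, List.singleton_append]
      rcases h with ⟨rfl, h⟩ | ⟨rfl, h⟩ | ⟨h | h, rfl, rfl, -⟩
      · exact ih h _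
      · exact across_of_seam (by rw [across_cons 2 _ rfl]; rfl) h
      · exact ⟨_, across_of_onSide (by rw [across_cons 3 _ rfl]; rfl) h⟩
      · exact ⟨_, across_of_onSide (by rw [across_cons 4 _ rfl]; rfl) h⟩

theorem Glued.touches {w w' : Word} {d d' : Dir} (h : Glued w d w' d') :
    Touches w.reverse w'.reverse := by
  have : ∃ t, across w.reverse d = (w'.reverse, t) := by
    rcases h with h | ⟨⟨e, h⟩, rfl, -⟩
    · simpa using across_of_interiorGlued h []
    · exact ⟨false, by simpa using across_of_onSide (A := []) (B := []) rfl h⟩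
  obtain ⟨t, ht⟩ := this
  have := touches_across w.reverse d
  rwa [ht] at this

theorem touches_of_adj {m : ℕ} {v w : Cell m} (h : (cellGraph m).Adj v w) :
    Touches v.toList.reverse w.toList.reverse := by
  rw [cellGraph, SimpleGraph.fromRel_adj] at h
  obtain ⟨-, ⟨d, d', h⟩ | ⟨d, d', h⟩⟩ := h
  · exact h.touches
  · exact h.touches.symm

/-! ### Counting the cells of a ball -/

theorem touches_drop_of_mem_ball {m n k : ℕ} {v w : Cell m} (hn : n ≤ 2 ^ k)
    (h : w ∈ ball m v n) :
    Touches (v.toList.reverse.drop k) (w.toList.reverse.drop k) := by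
  have h' : (cellGraph m).edist v w ≤ n := h
  obtain ⟨p, hp⟩ := SimpleGraph.exists_walk_of_edist_ne_top
    (ne_top_of_le_ne_top (ENat.natCast_ne_top n) h')
  have hlen : p.length ≤ 2 ^ k := by
    rw [← hp] at h'
    exact (Nat.cast_le.mp h').trans hn
  have := touches_drop (fun i => (p.getVert i).toList.reverse) (fun i => ?_) k
  · simpa [p.getVert_of_length_le hlen] using this
  · by_cases hi : i < p.length
    · exact touches_of_adj (p.adj_getVert_succ hi)
    · rw [p.getVert_of_length_le (by omega), p.getVert_of_length_le (by omega)]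
      exact .refl _

/-- The cells that touch `v`, as a finite set. -/
def touching (v : Word) : Finset Word :=
  insert v (Finset.univ.biUnion fun c => {antiCell v c, (seamCorner v c).1,
    (anti (seam (v, c))).1})

theorem Touches.mem_touching {v w : Word} (h : Touches v w) : w ∈ touching v := by
  obtain ⟨c, c', h⟩ := h
  simp only [touching, Finset.mem_insert, Finset.mem_biUnion, Finset.mem_univ, true_and,
    Finset.mem_singleton]
  simp only [star, Finset.mem_insert, Finset.mem_singleton] at h
  rcases h with h | h | h | h
  · exact .inl (congrArg Prod.fst h)
  · exact .inr ⟨c, .inl (congrArg Prod.fst h)⟩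
  · exact .inr ⟨c, .inr (.inl (congrArg Prod.fst h))⟩
  · exact .inr ⟨c, .inr (.inr (congrArg Prod.fst h))⟩

theorem card_touching_le (v : Word) : (touching v).card ≤ 25 := by
  refine (Finset.card_insert_le _ _).trans (Nat.succ_le_succ ?_)
  exact Finset.card_biUnion_le_card_mul Finset.univ _ 3 fun c _ => Finset.card_le_three

theorem ncard_ball_le {m n k : ℕ} (v : Cell m) (hn : n ≤ 2 ^ k) (hk : k ≤ m) :
    (ball m v n).ncard ≤ 25 * 8 ^ k := by
  -- A cell is determined by its ancestor `k` levels up and its last `k` letters.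
  let code (w : Cell m) : Word × Cell k :=
    (w.toList.reverse.drop k, ⟨w.toList.reverse.take k, by simp [hk]⟩)
  have hcode : Function.Injective code := by
    intro w w' h
    obtain ⟨h₁, h₂⟩ := Prod.mk.inj h
    have h₂ := congrArg List.Vector.toList h₂
    apply List.Vector.toList_injective
    rw [← List.reverse_inj, ← List.take_append_drop k w.toList.reverse, h₁]
    conv_rhs => rw [← List.take_append_drop k w'.toList.reverse]
    congr 1
  have hmaps : ∀ w ∈ ball m v n,
      code w ∈ ((touching (v.toList.reverse.drop k) ×ˢ Finset.univ : Finset (Word × Cell k)) :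
        Set (Word × Cell k)) := fun w hw => by
    simpa using (touches_drop_of_mem_ball hn hw).mem_touching
  calc (ball m v n).ncard
      ≤ ((touching (v.toList.reverse.drop k) ×ˢ Finset.univ : Finset (Word × Cell k)) :
          Set (Word × Cell k)).ncard :=
        Set.ncard_le_ncard_of_injOn code hmaps hcode.injOn (Finset.finite_toSet _)
    _ = (touching (v.toList.reverse.drop k)).card * 8 ^ k := by
        rw [Set.ncard_coe_finset, Finset.card_product, Finset.card_univ, card_vector, ZMod.card]
    _ ≤ 25 * 8 ^ k := Nat.mul_le_mul_right _ (card_touching_le _)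

end POG

theorem proposition9p15 (m n : ℕ) (hn : 1 ≤ n) (hnm : n < 2 ^ (m - 1)) (v : POG.Cell m) :
    (POG.ball m v n).ncard ≤ 200 * n ^ 3 := by
  have hlow : 2 ^ Nat.log 2 n ≤ n := Nat.pow_log_le_self 2 (by omega)
  have hlog : Nat.log 2 n < m - 1 := (Nat.pow_lt_pow_iff_right one_lt_two).1 (hlow.trans_lt hnm)
  -- With `k = log₂ n + 1` one has `n ≤ 2 ^ k` and `8 ^ k ≤ 8 * n ^ 3`.
  calc (POG.ball m v n).ncard
      ≤ 25 * 8 ^ (Nat.log 2 n + 1) :=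
        POG.ncard_ball_le v (Nat.lt_pow_succ_log_self one_lt_two n).le (by omega)
    _ = 200 * (2 ^ Nat.log 2 n) ^ 3 := by
        rw [← pow_mul, mul_comm _ 3, pow_mul 2 3]
        ring
    _ ≤ 200 * n ^ 3 := Nat.mul_le_mul_left _ (Nat.pow_le_pow_left hlow 3)
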